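/- Let $G$ be a finite solvable group and let $\gamma$ be a positive integer. If every complemented chief factor of $G$ is a $\gamma$-module, then $G$ has the $(\gamma+1)$-intersection property. Here the terms have the following meaning. A chief factor of $G$ is a quotient $X/Y$, where $Y<X$ are normal subgroups of $G$ with no normal subgroup of $G$ strictly between them. It is complemented if there is a subgroup $K\le G$ with $KX=G$ and $K\cap X=Y$. Since $G$ is solvable, $X/Y$ is abelian, and it is an irreducible $G$-module under conjugation. For an irreducible $G$-module $V$, put $F=\operatorname{End}_G(V)$ and, for $W\subseteq V$, let $C_G(W)$ be the pointwise stabilizer of $W$ in $G$. Then $V$ is a $\gamma$-module if for every $F$-subspace $W$ of $V$ there is an $F$-subspace $W^*$ of $V$ with $\dim_F W^*\le\gamma$ and $$C_G(W)=C_G(W^*)\cap\bigcap_{M\in\mathcal M_W}M,$$ where $\mathcal M_W$ is the set of maximal subgroups of $G$ containing $C_G(W)$ (an empty intersection is $G$). For a real number $\eta>0$, $G$ has the $\eta$-intersection property if every subgroup $H$ of $G$ that is an intersection of maximal subgroups of $G$ can be written as $H=M_1\cap\dots\cap M_t$ with maximal subgroups $M_1,\dots,M_t$ of $G$ such that $$|G:M_1|\cdots|G:M_t|\le|G:H|^{\eta}.$$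 -/

import Mathlib

namespace MaxInter

universe u v

section Intersections

variable {G : Type u} [Group G]

/-- `H` is a maximal intersection in `G`: an intersection of maximal subgroups of `G`
(the empty intersection being `G`). -/
def IsMaximalIntersection (H : Subgroup G) : Prop :=
  ∃ S : Set (Subgroup G), (∀ M ∈ S, IsCoatom M) ∧ H = sInf S

/-- `H` is an `η`-intersection in `G`: there are maximal subgroups `M₁, …, M_t` of `G` with
`H = M₁ ∩ ⋯ ∩ M_t` and `|G : M₁| ⋯ |G : M_t| ≤ |G : H| ^ η`. -/
def IsEtaIntersection (η : ℝ) (H : Subgroup G) : Prop :=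
  ∃ (t : ℕ) (M : Fin t → Subgroup G), (∀ i, IsCoatom (M i)) ∧ H = ⨅ i, M i ∧
    ∏ i, ((M i).index : ℝ) ≤ (H.index : ℝ) ^ η

variable (G) in
/-- `G` has the `η`-intersection property: every maximal intersection in `G` is an
`η`-intersection. -/
def HasIntersectionProperty (η : ℝ) : Prop :=
  ∀ H : Subgroup G, IsMaximalIntersection H → IsEtaIntersection η H

end Intersections

section Modules

variable (G : Type u) [Group G] (V : Type v) [AddCommGroup V] [DistribMulAction G V]

/-- A `G`-module is irreducible if it is nonzero and has no `G`-submodules besides `0` and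
itself. -/
def IsIrreducibleModule : Prop :=
  Nontrivial V ∧ ∀ U : AddSubgroup V, (∀ (g : G), ∀ u ∈ U, g • u ∈ U) → U = ⊥ ∨ U = ⊤

/-- `End_G(V)`: the ring of additive endomorphisms of `V` commuting with the action of `G`.
It acts on `V` by evaluation. -/
abbrev EndG : Subring (AddMonoid.End V) :=
  Subring.centralizer (Set.range (DistribMulAction.toAddMonoidEnd G V))

variable {V} in
/-- `C_G(W)`, the pointwise stabilizer in `G` of a subset `W` of `V`. -/
abbrev cent (W : Set V) : Subgroup G := fixingSubgroup G W

/-- The (irreducible) `G`-module `V` is a `γ`-module: with `F = End_G(V)`, for every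
`F`-subspace `W` of `V` there is an `F`-subspace `W*` of dimension at most `γ` such that
`C_G(W)` is the intersection of `C_G(W*)` with all the maximal subgroups of `G` containing
`C_G(W)`. -/
def IsGammaModule (γ : ℕ) : Prop :=
  ∀ W : Submodule (EndG G V) V, ∃ W' : Submodule (EndG G V) V,
    Module.rank (EndG G V) W' ≤ γ ∧
    cent G (W : Set V) =
      cent G (W' : Set V) ⊓ sInf {M : Subgroup G | IsCoatom M ∧ cent G (W : Set V) ≤ M}

end Modules

/-- A chief factor `top / bot` of `G`: `bot < top` are normal subgroups of `G` with no normal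
subgroup of `G` strictly between them. -/
structure ChiefFactor (G : Type u) [Group G] where
  top : Subgroup G
  bot : Subgroup G
  top_normal : top.Normal
  bot_normal : bot.Normal
  lt : bot < top
  minimal : ∀ N : Subgroup G, N.Normal → bot ≤ N → N ≤ top → N = bot ∨ N = top

namespace ChiefFactor

variable {G : Type u} [Group G] (c : ChiefFactor G)

instance : c.top.Normal := c.top_normal
instance : c.bot.Normal := c.bot_normal

/-- `top / bot` has a complement `K / bot` in `G / bot`. -/
def IsComplemented : Prop :=
  ∃ K : Subgroup G, K ⊔ c.top = ⊤ ∧ K ⊓ c.top = c.bot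

/-- The factor group `top / bot`, written additively. -/
def Carrier : Type u := Additive (c.top ⧸ c.bot.subgroupOf c.top)

instance : AddGroup c.Carrier :=
  inferInstanceAs (AddGroup (Additive (c.top ⧸ c.bot.subgroupOf c.top)))

/-- The class of `x ∈ top` in `top / bot`. -/
def cls (x : c.top) : c.Carrier :=
  Additive.ofMul (QuotientGroup.mk x : c.top ⧸ c.bot.subgroupOf c.top)

theorem cls_surjective : Function.Surjective c.cls := fun v => by
  obtain ⟨x, hx⟩ := QuotientGroup.mk_surjective (Additive.toMul v)
  exact ⟨x, hx⟩

theorem cls_mul (x y : c.top) : c.cls (x * y) = c.cls x + c.cls y := rfl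

theorem cls_eq_cls {x y : c.top} : c.cls x = c.cls y ↔ (x⁻¹ * y : G) ∈ c.bot := by
  have : c.cls x = c.cls y ↔ (QuotientGroup.mk x : c.top ⧸ c.bot.subgroupOf c.top) =
    QuotientGroup.mk y := Iff.rfl
  rw [this, QuotientGroup.eq, Subgroup.mem_subgroupOf]
  simp

/-- The automorphism `x bot ↦ (g x g⁻¹) bot` of `top / bot` induced by conjugation by `g`. -/
def conjHom (g : G) :
    (c.top ⧸ c.bot.subgroupOf c.top) →* (c.top ⧸ c.bot.subgroupOf c.top) :=
  QuotientGroup.map (c.bot.subgroupOf c.top) (c.bot.subgroupOf c.top)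
    (MulAut.conjNormal g : MulAut c.top).toMonoidHom
    (fun x hx => by
      simpa [Subgroup.mem_subgroupOf] using c.bot_normal.conj_mem _ hx g)

/-- `G` acts on `top / bot` by conjugation: `g • (x bot) = (g x g⁻¹) bot`. -/
instance : SMul G c.Carrier where
  smul g v := Additive.ofMul (c.conjHom g (Additive.toMul v))

theorem smul_cls (g : G) (x : c.top) :
    g • c.cls x = c.cls ⟨g * x * g⁻¹, c.top_normal.conj_mem _ x.2 g⟩ := rfl

instance : DistribMulAction G c.Carrier where
  one_smul v := by
    obtain ⟨x, rfl⟩ := c.cls_surjective v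
    simp [smul_cls]
  mul_smul g h v := by
    obtain ⟨x, rfl⟩ := c.cls_surjective v
    simp [smul_cls, mul_assoc]
  smul_zero g := map_one (c.conjHom g)
  smul_add g v w := by
    obtain ⟨x, rfl⟩ := c.cls_surjective v
    obtain ⟨y, rfl⟩ := c.cls_surjective w
    rw [← cls_mul, smul_cls, smul_cls, smul_cls, ← cls_mul]
    congr 1
    ext
    simp [mul_assoc]

/-- A chief factor of a solvable group is abelian. -/
theorem commutator_le [Group.IsSolvable G] : ⁅c.top, c.top⁆ ≤ c.bot := by
  have hle : ⁅c.top, c.top⁆ ⊔ c.bot ≤ c.top :=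
    sup_le (Subgroup.commutator_le_left _ _) c.lt.le
  rcases c.minimal (⁅c.top, c.top⁆ ⊔ c.bot) inferInstance le_sup_right hle with h | h
  · exact le_sup_left.trans h.le
  · exfalso
    have hne : c.top.map (QuotientGroup.mk' c.bot) ≠ ⊥ := by
      intro h0
      rw [Subgroup.map_eq_bot_iff, QuotientGroup.ker_mk'] at h0
      exact absurd h0 c.lt.not_ge
    have hlt := Group.IsSolvable.commutator_lt_of_ne_bot hne
    rw [← Subgroup.map_commutator] at hlt
    refine hlt.ne ?_
    conv_rhs => rw [← h]
    rw [Subgroup.map_sup, (Subgroup.map_eq_bot_iff c.bot).2 (by simp), sup_bot_eq]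

/-- The additive group underlying the `G`-module `top / bot`, for solvable `G`. -/
instance [Group.IsSolvable G] : AddCommGroup c.Carrier where
  add_comm v w := by
    obtain ⟨x, rfl⟩ := c.cls_surjective v
    obtain ⟨y, rfl⟩ := c.cls_surjective w
    rw [← cls_mul, ← cls_mul, cls_eq_cls]
    have := c.commutator_le (Subgroup.commutator_mem_commutator
      (c.top.inv_mem y.2) (c.top.inv_mem x.2))
    simpa [commutatorElement_def, mul_assoc] using this

/-- A chief factor of a solvable group is an irreducible `G`-module. -/
theorem isIrreducibleModule [Group.IsSolvable G] : IsIrreducibleModule G c.Carrier := by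
  refine ⟨?_, fun U hU => ?_⟩
  · obtain ⟨x, hx, hxb⟩ := SetLike.exists_of_lt c.lt
    refine ⟨⟨c.cls ⟨x, hx⟩, c.cls 1, fun h => hxb ?_⟩⟩
    have := c.cls_eq_cls.1 h.symm
    simpa using this
  · let N : Subgroup G :=
      { carrier := {x | ∃ h : x ∈ c.top, c.cls ⟨x, h⟩ ∈ U}
        one_mem' := ⟨c.top.one_mem, U.zero_mem⟩
        mul_mem' := fun ⟨ha, ha'⟩ ⟨hb, hb'⟩ => ⟨c.top.mul_mem ha hb, U.add_mem ha' hb'⟩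
        inv_mem' := fun ⟨ha, ha'⟩ => ⟨c.top.inv_mem ha, U.neg_mem ha'⟩ }
    have hmem : ∀ x : c.top, (x : G) ∈ N ↔ c.cls x ∈ U := fun x =>
      ⟨fun ⟨_, h⟩ => h, fun h => ⟨x.2, h⟩⟩
    have hN : N.Normal := ⟨fun x ⟨hx, hx'⟩ g => by
      have := hU g _ hx'
      rw [smul_cls] at this
      exact ⟨c.top_normal.conj_mem x hx g, this⟩⟩
    have hb : c.bot ≤ N := fun x hx => by
      refine ⟨c.lt.le hx, ?_⟩
      have : c.cls ⟨x, c.lt.le hx⟩ = c.cls 1 := (c.cls_eq_cls.2 (by simpa using hx)).symm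
      rw [this]
      exact U.zero_mem
    rcases c.minimal N hN hb (fun x hx => hx.1) with h | h
    · left
      rw [eq_bot_iff]
      intro v hv
      obtain ⟨x, rfl⟩ := c.cls_surjective v
      have hx : (x : G) ∈ c.bot := h ▸ (hmem x).2 hv
      exact (c.cls_eq_cls (x := 1) (y := x)).2 (by simpa using hx) |>.symm
    · right
      rw [eq_top_iff]
      intro v _
      obtain ⟨x, rfl⟩ := c.cls_surjective v
      exact (hmem x).1 (h.ge x.2)

end ChiefFactor

end MaxInter

/-! The proof is an induction on a normal subgroup K ≤ H, descending from K = G. Let N/K be a chief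
factor with N not in H, let X be the intersection of the maximal subgroups containing HN, and let L
be a maximal subgroup containing H but not N. Then L complements N/K, and |G:L| = |N/K|.

A maximal subgroup M ≥ H not containing N falls under one of two cases. If M ∩ C_G(N/K) ≤ L, then M
is the conjugate of L by some n ∈ N (`exists_eq_map_conj`); H fixes the class of n, and every
element of L fixing that class lies in M. Otherwise (L ∩ M)N is a maximal subgroup, so it contains
X, and it meets L inside M (`sup_inf_isCoatom`). Hence H = X ∩ L ∩ C_G(W), where W is the space of
H-fixed vectors of N/K.

The γ-module condition replaces W by at most γ vectors, because the extra maximal subgroups it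
involves contain HN, hence X. Each vector costs one conjugate of L, so H arises from X by adding at
most γ + 1 subgroups of index |G:L|. Since |G:X||G:L| ≤ |G:H|, the exponent γ + 1 is preserved. -/

namespace MaxInter

/-! ### Subgroups, indices and p-group actions -/

section Groups

variable {G : Type*} [Group G]

/-- An intersection of maximal subgroups indexed by any finite type may be used in place of one
indexed by `Fin t`. -/
theorem IsEtaIntersection.of_fintype {η : ℝ} {H : Subgroup G} {ι : Type*} [Fintype ι]
    (M : ι → Subgroup G) (hM : ∀ i, IsCoatom (M i)) (hH : H = ⨅ i, M i)
    (hη : ∏ i, ((M i).index : ℝ) ≤ (H.index : ℝ) ^ η) : IsEtaIntersection η H := by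
  let e := (Fintype.equivFin ι).symm
  refine ⟨Fintype.card ι, M ∘ e, fun i => hM _, ?_, ?_⟩
  · rw [hH]
    exact (e.iInf_comp (g := M)).symm
  · exact (e.prod_comp fun i => ((M i).index : ℝ)).trans_le hη

theorem sup_inf_le_of_le_of_normal {A B C : Subgroup G} [B.Normal] (h : A ≤ C) :
    (A ⊔ B) ⊓ C ≤ A ⊔ B ⊓ C := by
  rintro x ⟨hx, hC⟩
  obtain ⟨a, ha, b, hb, rfl⟩ := Subgroup.mem_sup_of_normal_right.1 hx
  exact mul_mem (Subgroup.mem_sup_left ha)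
    (Subgroup.mem_sup_right ⟨hb, (C.mul_mem_cancel_left (h ha)).1 hC⟩)

/-- Congruence for the number of fixed points of a subgroup acting through a `p`-group. -/
theorem card_modEq_card_fixed_of_pow_smul {α : Type*} [MulAction G α] [Finite α] {p : ℕ}
    [Fact p.Prime] (S : Subgroup G) (h : ∀ s ∈ S, ∀ a : α, s ^ p • a = a) :
    Nat.card α ≡ Nat.card {a : α // ∀ s ∈ S, s • a = a} [MOD p] := by
  have hP : IsPGroup p (S.map (MulAction.toPermHom G α)) := by
    rintro ⟨_, s, hs, rfl⟩
    refine ⟨1, ?_⟩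
    refine Subtype.ext ?_
    change (MulAction.toPermHom G α s) ^ p ^ 1 = 1
    rw [pow_one, ← map_pow]
    exact Equiv.ext (h s hs)
  convert hP.card_modEq_card_fixedPoints α using 1
  refine Nat.card_congr (Equiv.subtypeEquivRight fun a => ?_)
  constructor
  · rintro ha ⟨_, s, hs, rfl⟩
    exact ha s hs
  · intro ha s hs
    exact ha ⟨_, s, hs, rfl⟩

theorem relIndex_eq_index_of_sup_eq_top {L X : Subgroup G} [X.Normal] [Finite G]
    (h : L ⊔ X = ⊤) : L.relIndex X = L.index := by
  have h1 : X.relIndex L = X.index := by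
    rw [← Subgroup.relIndex_sup_right, h, Subgroup.relIndex_top_right]
  have h2 : (L ⊓ X).relIndex X * X.index = (L ⊓ X).index :=
    Subgroup.relIndex_mul_index inf_le_right
  have h3 : (L ⊓ X).relIndex L * L.index = (L ⊓ X).index :=
    Subgroup.relIndex_mul_index inf_le_left
  rw [Subgroup.inf_relIndex_right] at h2
  rw [Subgroup.inf_relIndex_left, h1] at h3
  have : 0 < X.index := Nat.pos_of_ne_zero Subgroup.index_ne_zero_of_finite
  refine Nat.eq_of_mul_eq_mul_right this ?_
  rw [h2, ← h3, mul_comm]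

theorem isCoatom_map_conj {L : Subgroup G} (hL : IsCoatom L) (g : G) :
    IsCoatom (L.map (MulAut.conj g).toMonoidHom) :=
  (OrderIso.isCoatom_iff (MulAut.conj g).mapSubgroup L).2 hL

theorem mem_map_conj {L : Subgroup G} {g x : G} :
    x ∈ L.map (MulAut.conj g).toMonoidHom ↔ g⁻¹ * x * g ∈ L := by
  rw [Subgroup.mem_map]
  constructor
  · rintro ⟨y, hy, rfl⟩
    simpa [mul_assoc] using hy
  · intro h
    exact ⟨_, h, by simp [mul_assoc]⟩

theorem index_map_conj (L : Subgroup G) (g : G) :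
    (L.map (MulAut.conj g).toMonoidHom).index = L.index :=
  Subgroup.index_map_equiv L (MulAut.conj g)

/-- Two distinct maximal subgroups cannot both normalize a subgroup unless it is normal. -/
theorem normal_of_le_normalizer {L M S : Subgroup G} (hL : IsCoatom L) (hM : IsCoatom M)
    (hne : L ≠ M) (h1 : L ≤ Subgroup.normalizer (S : Set G)) (h2 : M ≤ Subgroup.normalizer (S : Set G)) : S.Normal := by
  rw [← Subgroup.normalizer_eq_top_iff]
  by_contra h
  have e1 := (hL.le_iff.1 h1).resolve_left h
  have e2 := (hM.le_iff.1 h2).resolve_left h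
  exact hne (e1.symm.trans e2)

/-- A proper normal subgroup of a finite group is the bottom of a chief factor. -/
theorem exists_chiefFactor_bot_eq [Finite G] (K : Subgroup G) [K.Normal] (hK : K ≠ ⊤) :
    ∃ c : ChiefFactor G, c.bot = K := by
  obtain ⟨N, hN⟩ := (Set.toFinite {N : Subgroup G | N.Normal ∧ K < N}).exists_minimal
    ⟨⊤, inferInstance, hK.lt_top⟩
  refine ⟨⟨N, K, hN.1.1, inferInstance, hN.1.2, fun A hA h1 h2 => ?_⟩, rfl⟩
  rcases h1.eq_or_lt with h | h
  · exact Or.inl h.symm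
  · exact Or.inr (le_antisymm h2 (hN.2 ⟨hA, h⟩ h2))

end Groups

/-! ### Centralizers and maximal supplements of chief factors -/

namespace ChiefFactor

variable {G : Type*} [Group G] (c : ChiefFactor G)

/-- The centralizer in `G` of a chief factor. -/
def centralizer : Subgroup G := (MulAction.toPermHom G c.Carrier).ker

instance : c.centralizer.Normal := inferInstanceAs (MonoidHom.ker _).Normal

theorem mem_centralizer {g : G} : g ∈ c.centralizer ↔ ∀ v : c.Carrier, g • v = v :=
  MonoidHom.mem_ker.trans Equiv.ext_iff

theorem smul_cls_eq_iff {g : G} {x : c.top} :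
    g • c.cls x = c.cls x ↔ (g⁻¹ * (x : G)⁻¹ * g * x) ∈ c.bot := by
  have h : g • c.cls x = c.cls x ↔ (g * (x : G)⁻¹ * g⁻¹ * x) ∈ c.bot := by
    rw [smul_cls, cls_eq_cls]
    simp [mul_assoc]
  have h' : g • c.cls x = c.cls x ↔ g⁻¹ • c.cls x = c.cls x := by
    rw [inv_smul_eq_iff, eq_comm]
  rw [h', smul_cls, cls_eq_cls]
  simp [mul_assoc]

theorem commutator_mem_bot {g x : G} (hg : g ∈ c.centralizer) (hx : x ∈ c.top) :
    g⁻¹ * x⁻¹ * g * x ∈ c.bot :=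
  c.smul_cls_eq_iff.1 (c.mem_centralizer.1 hg (c.cls ⟨x, hx⟩))

theorem mem_centralizer_of_commutator {g : G}
    (h : ∀ x ∈ c.top, g⁻¹ * x⁻¹ * g * x ∈ c.bot) : g ∈ c.centralizer := by
  rw [mem_centralizer]
  intro v
  obtain ⟨x, rfl⟩ := c.cls_surjective v
  exact c.smul_cls_eq_iff.2 (h x x.2)

theorem top_le_centralizer [Group.IsSolvable G] : c.top ≤ c.centralizer := fun g hg =>
  c.mem_centralizer_of_commutator fun x hx => by
    have := c.commutator_le (Subgroup.commutator_mem_commutator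
      (c.top.inv_mem hg) (c.top.inv_mem hx))
    simpa [commutatorElement_def, mul_assoc] using this

instance [Finite G] : Finite c.Carrier := Finite.of_surjective _ c.cls_surjective

theorem card_carrier : Nat.card c.Carrier = c.bot.relIndex c.top := rfl

/-- `L` is a maximal subgroup containing the bottom, but not the top, of a chief factor. -/
structure IsMaximalSupplement (L : Subgroup G) : Prop where
  isCoatom : IsCoatom L
  bot_le : c.bot ≤ L
  not_le : ¬ c.top ≤ L

variable {c}

namespace IsMaximalSupplement

variable {L M : Subgroup G} (hL : c.IsMaximalSupplement L) (hM : c.IsMaximalSupplement M)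

include hL

theorem sup_top : L ⊔ c.top = ⊤ :=
  (hL.isCoatom.le_iff.1 le_sup_left).resolve_right fun h => hL.not_le (h ▸ le_sup_right)

/-- A subgroup invariant under `L` and `top` is normal. -/
theorem normal_of_conj {S : Subgroup G} (h1 : ∀ g ∈ L, ∀ s ∈ S, g * s * g⁻¹ ∈ S)
    (h2 : ∀ g ∈ c.top, ∀ s ∈ S, g * s * g⁻¹ ∈ S) : S.Normal := by
  refine ⟨fun s hs g => ?_⟩
  obtain ⟨l, hl, n, hn, rfl⟩ :=
    Subgroup.mem_sup_of_normal_right.1 (hL.sup_top ▸ Subgroup.mem_top g : g ∈ L ⊔ c.top)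
  have := h1 l hl _ (h2 n hn s hs)
  simpa [mul_assoc] using this

/-- For s in the intersection and n in `c.top`, the conjugate of s by n differs from s by a
commutator in `c.bot ≤ L`; and G = L · `c.top`. -/
theorem inf_centralizer_normal : (L ⊓ c.centralizer).Normal := by
  refine hL.normal_of_conj (fun g hg s hs => ⟨?_, ?_⟩) (fun g hg s hs => ⟨?_, ?_⟩)
  · exact L.mul_mem (L.mul_mem hg hs.1) (L.inv_mem hg)
  · exact Subgroup.Normal.conj_mem inferInstance s hs.2 g
  · have := hL.bot_le (c.commutator_mem_bot hs.2 (c.top.inv_mem hg))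
    have := L.mul_mem hs.1 this
    simpa [mul_assoc] using this
  · exact Subgroup.Normal.conj_mem inferInstance s hs.2 g

variable [Group.IsSolvable G]

theorem inf_top : L ⊓ c.top = c.bot := by
  have hn : (L ⊓ c.top).Normal := by
    refine hL.normal_of_conj (fun g hg s hs => ⟨?_, ?_⟩) (fun g hg s hs => ⟨?_, ?_⟩)
    · exact L.mul_mem (L.mul_mem hg hs.1) (L.inv_mem hg)
    · exact c.top_normal.conj_mem s hs.2 g
    · have := hL.bot_le (c.commutator_mem_bot (c.top_le_centralizer hs.2) (c.top.inv_mem hg))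
      have := L.mul_mem hs.1 this
      simpa [mul_assoc] using this
    · exact c.top_normal.conj_mem s hs.2 g
  exact (c.minimal _ hn (le_inf hL.bot_le c.lt.le) inf_le_right).resolve_right
    fun h => hL.not_le (h ▸ inf_le_left)

theorem isComplemented : c.IsComplemented := ⟨L, hL.sup_top, hL.inf_top⟩

theorem index_eq [Finite G] : L.index = Nat.card c.Carrier := by
  rw [← relIndex_eq_index_of_sup_eq_top hL.sup_top, card_carrier, ← hL.inf_top,
    Subgroup.inf_relIndex_right]

/-- Since n⁻¹ln = l · (l⁻¹n⁻¹ln) and the commutator lies in `c.top`, membership in L means that the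
commutator lies in L ∩ `c.top` = `c.bot`. Vectors thus correspond to conjugates of L. -/
theorem mem_conj_iff {l : G} (hl : l ∈ L) (n : c.top) :
    l ∈ L.map (MulAut.conj (n : G)).toMonoidHom ↔ l • c.cls n = c.cls n := by
  rw [mem_map_conj, smul_cls_eq_iff, ← hL.inf_top]
  constructor
  · intro h
    refine ⟨?_, ?_⟩
    · have := L.mul_mem (L.inv_mem hl) h
      simpa [mul_assoc] using this
    · exact mul_mem (by
        have := c.top_normal.conj_mem _ (c.top.inv_mem n.2) l⁻¹
        simpa using this) n.2
  · intro h
    have := L.mul_mem hl h.1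
    simpa [mul_assoc] using this

include hM

/-- The normal subgroup B = M ∩ C is not in L, so LB = G and M = (L ∩ M)B. For Q above (L ∩ M) ·
`c.top`, the subgroup (Q ∩ L)B contains M, so it is G or M: the first forces L ≤ Q and Q = G, the
second Q ∩ L ≤ M and no growth. -/
theorem sup_inf_isCoatom (h : ¬ M ⊓ c.centralizer ≤ L) :
    IsCoatom (L ⊓ M ⊔ c.top) ∧ (L ⊓ M ⊔ c.top) ⊓ L ≤ M := by
  have hB := hM.inf_centralizer_normal
  have hle : (L ⊓ M ⊔ c.top) ⊓ L ≤ L ⊓ M := by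
    refine (sup_inf_le_of_le_of_normal inf_le_left).trans (sup_le le_rfl ?_)
    rw [inf_comm, hL.inf_top]
    exact le_inf hL.bot_le hM.bot_le
  have hLB : L ⊔ M ⊓ c.centralizer = ⊤ :=
    (hL.isCoatom.le_iff.1 le_sup_left).resolve_right fun e => h (e ▸ le_sup_right)
  have hM' : M ≤ L ⊓ M ⊔ M ⊓ c.centralizer := by
    intro x hx
    obtain ⟨l, hl, b, hb, rfl⟩ :=
      Subgroup.mem_sup_of_normal_right.1 (hLB ▸ Subgroup.mem_top x : x ∈ L ⊔ M ⊓ c.centralizer)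
    exact mul_mem (Subgroup.mem_sup_left ⟨hl, (M.mul_mem_cancel_right hb.1).1 hx⟩)
      (Subgroup.mem_sup_right hb)
  refine ⟨⟨fun e => ?_, fun Q hQ => ?_⟩, hle.trans inf_le_right⟩
  · rw [e, top_inf_eq] at hle
    have hLM : L ≤ M := hle.trans inf_le_right
    rcases hL.isCoatom.le_iff.1 hLM with e | e
    · exact hM.isCoatom.1 e
    · exact h (e ▸ inf_le_left)
  · have hNQ : c.top ≤ Q := le_sup_right.trans hQ.le
    have hLMQ : L ⊓ M ≤ Q ⊓ L := le_inf (le_sup_left.trans hQ.le) inf_le_left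
    have hMJ : M ≤ Q ⊓ L ⊔ M ⊓ c.centralizer :=
      hM'.trans (sup_le_sup_right hLMQ _)
    rcases hM.isCoatom.le_iff.1 hMJ with e | e
    · have h1 : L ≤ Q ⊓ L := by
        have h2 : (Q ⊓ L ⊔ M ⊓ c.centralizer) ⊓ L ≤ Q ⊓ L ⊔ (M ⊓ c.centralizer) ⊓ L :=
          sup_inf_le_of_le_of_normal inf_le_right
        rw [e, top_inf_eq] at h2
        refine h2.trans (sup_le le_rfl (le_trans ?_ hLMQ))
        exact le_inf inf_le_right (inf_le_left.trans inf_le_left)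
      rw [eq_top_iff, ← hL.sup_top]
      exact sup_le (h1.trans inf_le_left) hNQ
    · exfalso
      refine hQ.not_ge ?_
      intro x hx
      obtain ⟨l, hl, n, hn, rfl⟩ :=
        Subgroup.mem_sup_of_normal_right.1 (hL.sup_top ▸ Subgroup.mem_top x : x ∈ L ⊔ c.top)
      have hlQ : l ∈ Q := (Q.mul_mem_cancel_right (hNQ hn)).1 hx
      refine mul_mem (Subgroup.mem_sup_left ⟨hl, ?_⟩) (Subgroup.mem_sup_right hn)
      exact e ▸ Subgroup.mem_sup_left (show l ∈ Q ⊓ L from ⟨hlQ, hl⟩)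

end IsMaximalSupplement

end ChiefFactor

/-! ### Coprimality and conjugacy of maximal supplements -/

namespace ChiefFactor

variable {G : Type*} [Group G] [Group.IsSolvable G] [Finite G]

/-- A chief factor of a finite solvable group has prime exponent. -/
theorem exists_prime_pow_mem_bot (c : ChiefFactor G) :
    ∃ p : ℕ, p.Prime ∧ ∀ x ∈ c.top, x ^ p ∈ c.bot := by
  obtain ⟨hnt, hirr⟩ := c.isIrreducibleModule
  have : Fintype c.Carrier := Fintype.ofFinite _
  obtain ⟨p, hp, hpd⟩ := Nat.exists_prime_and_dvd (Fintype.one_lt_card (α := c.Carrier)).ne'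
  have := Fact.mk hp
  obtain ⟨v, hv⟩ := exists_prime_addOrderOf_dvd_card p hpd
  refine ⟨p, hp, fun x hx => ?_⟩
  -- The vectors killed by p form a submodule, nonzero because it contains v.
  have key := hirr (nsmulAddMonoidHom (α := c.Carrier) p).ker (fun g u hu => by
    rw [AddMonoidHom.mem_ker, nsmulAddMonoidHom_apply] at hu ⊢
    exact ((DistribSMul.toAddMonoidHom c.Carrier g).map_nsmul p u).symm.trans
      ((congrArg (g • ·) hu).trans (smul_zero g)))
  have hvk : v ∈ (nsmulAddMonoidHom (α := c.Carrier) p).ker := by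
    rw [AddMonoidHom.mem_ker, nsmulAddMonoidHom_apply, ← hv, addOrderOf_nsmul_eq_zero]
  rcases key with h | h
  · rw [h, AddSubgroup.mem_bot] at hvk
    rw [hvk, addOrderOf_zero] at hv
    exact absurd hv.symm hp.one_lt.ne'
  · have hxk : c.cls ⟨x, hx⟩ ∈ (nsmulAddMonoidHom (α := c.Carrier) p).ker :=
      h ▸ AddSubgroup.mem_top _
    rw [AddMonoidHom.mem_ker, nsmulAddMonoidHom_apply] at hxk
    have h2 : ∀ k : ℕ, k • c.cls ⟨x, hx⟩ = c.cls (⟨x, hx⟩ ^ k) := by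
      intro k
      induction k with
      | zero => rw [zero_nsmul, pow_zero]; rfl
      | succ k ih => rw [succ_nsmul, pow_succ, cls_mul, ih]
    rw [h2] at hxk
    simpa using c.cls_eq_cls.1 ((show c.cls 1 = 0 from rfl).trans hxk.symm)

/-- A prime exponent of a chief factor lying directly above the centralizer of `c` does not
divide the order of `c`. -/
theorem not_dvd_card_of_bot_eq_centralizer (c d : ChiefFactor G) (hd : d.bot = c.centralizer)
    {r : ℕ} (hr : r.Prime) (h : ∀ x ∈ d.top, x ^ r ∈ d.bot) : ¬ r ∣ Nat.card c.Carrier := by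
  intro hdvd
  have := Fact.mk hr
  -- If r divided the order, the fixed vectors of `d.top` would form a nonzero submodule, hence
  -- everything, and `d.top` would centralize `c`.
  have hcard := card_modEq_card_fixed_of_pow_smul (α := c.Carrier) (p := r) d.top
    fun s hs a => c.mem_centralizer.1 (hd ▸ h s hs) a
  let U : AddSubgroup c.Carrier :=
    { carrier := {a | ∀ s ∈ d.top, s • a = a}
      zero_mem' := fun s _ => smul_zero s
      add_mem' := fun ha hb s hs => by rw [smul_add, ha s hs, hb s hs]
      neg_mem' := fun ha s hs => by rw [smul_neg, ha s hs] }
  have hU : ∀ (g : G), ∀ u ∈ U, g • u ∈ U := fun g u hu s hs => by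
    have := hu _ (d.top_normal.conj_mem s hs g⁻¹)
    rw [inv_inv, mul_smul, mul_smul, inv_smul_eq_iff] at this
    exact this
  have hdU : r ∣ Nat.card U := (hcard.dvd_iff dvd_rfl).1 hdvd
  rcases c.isIrreducibleModule.2 U hU with e | e
  · rw [e, AddSubgroup.card_bot] at hdU
    exact hr.one_lt.ne' (Nat.dvd_one.1 hdU)
  · refine d.lt.not_ge fun s hs => ?_
    rw [hd, mem_centralizer]
    intro v
    exact (e ▸ AddSubgroup.mem_top v : v ∈ U) s hs

namespace IsMaximalSupplement

variable {c : ChiefFactor G} {L M : Subgroup G}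

omit [Group.IsSolvable G] [Finite G] in
theorem map_conj (hL : c.IsMaximalSupplement L) (g : G) :
    c.IsMaximalSupplement (L.map (MulAut.conj g).toMonoidHom) where
  isCoatom := isCoatom_map_conj hL.isCoatom g
  bot_le x hx := mem_map_conj.2 (hL.bot_le (by
    simpa using c.bot_normal.conj_mem x hx g⁻¹))
  not_le h := hL.not_le fun x hx => by
    have := mem_map_conj.1 (h (c.top_normal.conj_mem x hx g))
    simpa [mul_assoc] using this

omit [Finite G] in
/-- If `M ∩ T ≤ L` for some `T` containing the top of the chief factor then `L ∩ T ≤ M`. -/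
theorem inf_le_of_inf_le (hL : c.IsMaximalSupplement L) (hM : c.IsMaximalSupplement M)
    {T : Subgroup G} (hT : c.top ≤ T) (h : M ⊓ T ≤ L) : L ⊓ T ≤ M := by
  rintro x ⟨hx, hxT⟩
  obtain ⟨m, hm, n, hn, rfl⟩ :=
    Subgroup.mem_sup_of_normal_right.1 (hM.sup_top ▸ Subgroup.mem_top x : x ∈ M ⊔ c.top)
  have hmL := h ⟨hm, (T.mul_mem_cancel_right (hT hn)).1 hxT⟩
  refine M.mul_mem hm (hM.bot_le (hL.inf_top ▸ ?_))
  exact ⟨(L.mul_mem_cancel_left hmL).1 hx, hn⟩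

omit [Finite G] in
/-- A subgroup `T` containing the top of `c` centralizes `c` if its intersection with a maximal
supplement is normal. -/
theorem le_centralizer_of_inf_normal (hM : c.IsMaximalSupplement M) {T : Subgroup G}
    (hT : c.top ≤ T) (h : (M ⊓ T).Normal) : T ≤ c.centralizer := by
  -- Commutators of the normal subgroups M ∩ T and `c.top` lie in M ∩ `c.top` = `c.bot`.
  have h1 : M ⊓ T ≤ c.centralizer := fun s hs => c.mem_centralizer_of_commutator fun x hx => by
    rw [← hM.inf_top]
    refine ⟨?_, ?_⟩
    · have := mul_mem ((M ⊓ T).inv_mem hs) (h.conj_mem s hs x⁻¹)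
      simpa [mul_assoc] using this.1
    · have := mul_mem (c.top_normal.conj_mem x⁻¹ (c.top.inv_mem hx) s⁻¹) hx
      simpa [mul_assoc] using this
  intro x hxT
  obtain ⟨m, hm, n, hn, rfl⟩ :=
    Subgroup.mem_sup_of_normal_right.1 (hM.sup_top ▸ Subgroup.mem_top x : x ∈ M ⊔ c.top)
  exact mul_mem (h1 ⟨hm, (T.mul_mem_cancel_right (hT hn)).1 hxT⟩) (c.top_le_centralizer hn)

/-- Maximal supplements of a chief factor that meet its centralizer in the same subgroup are
conjugate. -/
theorem exists_eq_map_conj (hL : c.IsMaximalSupplement L) (hM : c.IsMaximalSupplement M)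
    (h : M ⊓ c.centralizer ≤ L) :
    ∃ n : c.top, M = L.map (MulAut.conj (n : G)).toMonoidHom := by
  by_cases hC : c.centralizer = ⊤
  · rw [hC, inf_top_eq] at h
    refine ⟨1, ?_⟩
    have : M = L := ((hM.isCoatom.le_iff.1 h).resolve_left hL.isCoatom.1).symm
    ext x
    rw [mem_map_conj, this]
    simp
  obtain ⟨d, hd⟩ := exists_chiefFactor_bot_eq c.centralizer hC
  obtain ⟨r, hr, hpow⟩ := d.exists_prime_pow_mem_bot
  have := Fact.mk hr
  have hT : c.top ≤ d.top := c.top_le_centralizer.trans (hd ▸ d.lt.le)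
  have hnd := c.not_dvd_card_of_bot_eq_centralizer d hd hr hpow
  have hA := hM.inf_centralizer_normal
  -- M ∩ C is normal and lies in L, so it acts trivially on G/L, and M ∩ `d.top` acts through an
  -- r-group. The number of cosets, |`c`|, is prime to r, so some coset is fixed.
  have hcard := card_modEq_card_fixed_of_pow_smul (α := G ⧸ L) (p := r) (M ⊓ d.top)
    fun s hs a => by
      obtain ⟨g, rfl⟩ := QuotientGroup.mk_surjective a
      change ((s ^ r * g : G) : G ⧸ L) = g
      rw [eq_comm, QuotientGroup.eq]
      refine h ?_
      have := hA.conj_mem _ ⟨M.pow_mem hs.1 r, hd ▸ hpow s hs.2⟩ g⁻¹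
      simpa [mul_assoc] using this
  obtain ⟨a, ha⟩ : Nonempty {a : G ⧸ L // ∀ s ∈ M ⊓ d.top, s • a = a} := by
    by_contra hne
    rw [not_nonempty_iff] at hne
    rw [Nat.card_of_isEmpty (α := {a : G ⧸ L // ∀ s ∈ M ⊓ d.top, s • a = a})] at hcard
    refine hnd ?_
    rw [← hL.index_eq]
    exact (Nat.modEq_zero_iff_dvd).1 hcard
  obtain ⟨g, rfl⟩ := QuotientGroup.mk_surjective a
  obtain ⟨n, hn, l, hl, rfl⟩ := Subgroup.mem_sup_of_normal_left.1
    ((sup_comm L c.top ▸ hL.sup_top) ▸ Subgroup.mem_top g : g ∈ c.top ⊔ L)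
  refine ⟨⟨n, hn⟩, ?_⟩
  set L' := L.map (MulAut.conj n).toMonoidHom
  have hL' : c.IsMaximalSupplement L' := hL.map_conj n
  have hle : M ⊓ d.top ≤ L' := fun s hs => by
    have h1 : ((s * (n * l) : G) : G ⧸ L) = (n * l : G) := ha s hs
    rw [eq_comm, QuotientGroup.eq] at h1
    have := L.mul_mem (L.mul_mem hl h1) (L.inv_mem hl)
    rw [mem_map_conj]
    simpa [mul_assoc] using this
  have heq : M ⊓ d.top = L' ⊓ d.top :=
    le_antisymm (le_inf hle inf_le_right) (le_inf (hL'.inf_le_of_inf_le hM hT hle) inf_le_right)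
  -- Two distinct maximal subgroups normalizing M ∩ `d.top` would make it normal, and `d.top` would
  -- centralize `c`.
  by_contra hne
  refine d.lt.not_ge (hd ▸ hM.le_centralizer_of_inf_normal hT ?_)
  refine normal_of_le_normalizer hM.isCoatom hL'.isCoatom hne ?_ ?_
  · rw [← Subgroup.normal_subgroupOf_iff_le_normalizer inf_le_left, Subgroup.inf_subgroupOf_left]
    infer_instance
  · rw [heq, ← Subgroup.normal_subgroupOf_iff_le_normalizer inf_le_left,
      Subgroup.inf_subgroupOf_left]
    infer_instance

end IsMaximalSupplement

end ChiefFactor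

/-! ### Schur's lemma and stabilizers of subspaces -/

section Schur

variable {G : Type*} [Group G] {V : Type*} [AddCommGroup V] [DistribMulAction G V]

theorem EndG.apply_smul (f : EndG G V) (g : G) (v : V) : f.1 (g • v) = g • f.1 v := by
  have h := Subring.mem_centralizer_iff.1 f.2 _ ⟨g, rfl⟩
  exact (DFunLike.congr_fun h v).symm

/-- Schur's lemma for finite irreducible modules. -/
theorem EndG.isUnit_or_eq_zero [Finite V] (hV : IsIrreducibleModule G V) (f : EndG G V) :
    IsUnit f ∨ f = 0 := by
  let f' : V →+ V := f.1
  rcases hV.2 f'.ker (fun g u hu => by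
    rw [AddMonoidHom.mem_ker] at hu ⊢
    exact (apply_smul f g u).trans (by rw [show f.1 u = 0 from hu, smul_zero])) with h | h
  · left
    have hb : Function.Bijective f' :=
      Finite.injective_iff_bijective.1 ((AddMonoidHom.ker_eq_bot_iff f').1 h)
    let e := AddEquiv.ofBijective f' hb
    have he : ∀ v, f.1 (e.symm v) = v := fun v => e.apply_symm_apply v
    have he' : ∀ v, e.symm (f.1 v) = v := fun v => e.symm_apply_apply v
    let i : EndG G V := ⟨(e.symm.toAddMonoidHom : V →+ V), Subring.mem_centralizer_iff.2 (by
      rintro _ ⟨g, rfl⟩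
      refine AddMonoidHom.ext fun v => hb.1 ?_
      change f.1 (g • e.symm v) = f.1 (e.symm (g • v))
      rw [apply_smul, he, he])⟩
    exact ⟨⟨f, i, Subtype.ext (AddMonoidHom.ext he), Subtype.ext (AddMonoidHom.ext he')⟩, rfl⟩
  · right
    refine Subtype.ext (AddMonoidHom.ext fun v => ?_)
    exact AddMonoidHom.mem_ker.1 (h ▸ AddSubgroup.mem_top v : v ∈ f'.ker)

/-- A subspace of dimension at most `γ` is spanned by at most `γ` vectors. -/
theorem exists_finset_span_eq [Finite V] (hV : IsIrreducibleModule G V) {γ : ℕ}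
    (W : Submodule (EndG G V) V) (hW : Module.rank (EndG G V) W ≤ γ) :
    ∃ s : Finset V, s.card ≤ γ ∧ Submodule.span (EndG G V) (s : Set V) = W := by
  have := hV.1
  have : Nontrivial (EndG G V) := by
    obtain ⟨v, hv⟩ := exists_ne (0 : V)
    exact ⟨⟨1, 0, fun h => hv (DFunLike.congr_fun (congrArg Subtype.val h) v)⟩⟩
  let _ : DivisionRing (EndG G V) := DivisionRing.ofIsUnitOrEqZero (EndG.isUnit_or_eq_zero hV)
  classical
  let b := Module.Free.chooseBasis (EndG G V) W
  have hr := b.mk_eq_rank''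
  have : Fintype (Module.Free.ChooseBasisIndex (EndG G V) W) :=
    @Fintype.ofFinite _ (Finite.of_injective b b.injective)
  refine ⟨Finset.univ.image fun i => (b i : V), ?_, ?_⟩
  · refine Finset.card_image_le.trans ?_
    rw [Finset.card_univ]
    rw [← hr, Cardinal.mk_fintype] at hW
    exact_mod_cast hW
  · have h := congrArg (Submodule.map W.subtype) b.span_eq
    rw [Submodule.map_span, Submodule.map_top, Submodule.range_subtype, ← Set.range_comp] at h
    refine Eq.trans ?_ h
    congr 1
    ext
    simp

/-- The stabilizer of the span of a set is the stabilizer of the set. -/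
theorem cent_span (s : Set V) :
    cent G (Submodule.span (EndG G V) s : Set V) = cent G s := by
  refine le_antisymm (fixingSubgroup_antitone G V Submodule.subset_span) fun g hg => ?_
  rw [mem_fixingSubgroup_iff] at hg ⊢
  intro v hv
  induction hv using Submodule.span_induction with
  | mem x hx => exact hg x hx
  | zero => exact smul_zero g
  | add x y _ _ hx hy => rw [smul_add, hx, hy]
  | smul f x _ hx => exact (EndG.apply_smul f g x).symm.trans (congrArg f.1 hx)

variable (V) in
/-- The subspace of vectors fixed by a subgroup. -/
def fixedSubmodule (H : Subgroup G) : Submodule (EndG G V) V where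
  carrier := {v | ∀ h ∈ H, h • v = v}
  zero_mem' h _ := smul_zero h
  add_mem' ha hb h hh := by rw [smul_add, ha h hh, hb h hh]
  smul_mem' f v hv h hh := (EndG.apply_smul f h v).symm.trans (congrArg f.1 (hv h hh))

theorem le_cent_fixedSubmodule (H : Subgroup G) : H ≤ cent G (fixedSubmodule V H : Set V) :=
  fun h hh => (mem_fixingSubgroup_iff G).2 fun _ hv => hv h hh

end Schur

/-! ### Induction over chief factors -/

section Main

variable {G : Type*} [Group G] [Group.IsSolvable G] [Finite G]

/-- The intersection of `L` with a stabilizer in the chief factor `c` is contained in every maximal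
supplement containing `H`, up to maximal subgroups containing the top of `c`. -/
theorem ChiefFactor.IsMaximalSupplement.inf_cent_inf_le {c : ChiefFactor G} {L M H X : Subgroup G}
    (hL : c.IsMaximalSupplement L) (hM : c.IsMaximalSupplement M) (hHL : H ≤ L) (hHM : H ≤ M)
    (hX : ∀ P, IsCoatom P → H ≤ P → c.top ≤ P → X ≤ P) :
    X ⊓ L ⊓ cent G (fixedSubmodule c.Carrier H : Set c.Carrier) ≤ M := by
  by_cases h : M ⊓ c.centralizer ≤ L
  · obtain ⟨n, rfl⟩ := hL.exists_eq_map_conj hM h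
    rintro l ⟨⟨-, hl⟩, hlc⟩
    rw [hL.mem_conj_iff hl]
    refine (mem_fixingSubgroup_iff G).1 hlc _ fun y hy => ?_
    exact (hL.mem_conj_iff (hHL hy) n).1 (hHM hy)
  · obtain ⟨h1, h2⟩ := hL.sup_inf_isCoatom hM h
    have h3 := hX _ h1 ((le_inf hHL hHM).trans le_sup_left) le_sup_right
    exact fun x hx => h2 ⟨h3 hx.1.1, hx.1.2⟩

/-- Extending an `η`-intersection from the intersection `X` of the maximal subgroups containing `H`
and the top of a chief factor to `H` itself. -/
theorem isEtaIntersection_of_chiefFactor {γ : ℕ} {c : ChiefFactor G} {L H X : Subgroup G}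
    (hc : IsGammaModule G c.Carrier γ) (hL : c.IsMaximalSupplement L)
    (hH : H = sInf {M | IsCoatom M ∧ H ≤ M}) (hbot : c.bot ≤ H) (hHL : H ≤ L)
    (hX : X = sInf {M | IsCoatom M ∧ H ≤ M ∧ c.top ≤ M})
    (hXη : IsEtaIntersection ((γ : ℝ) + 1) X) : IsEtaIntersection ((γ : ℝ) + 1) H := by
  obtain ⟨t, M₀, hM₀, hXM, hprod⟩ := hXη
  have hHX : H ≤ X := hX ▸ le_sInf fun M hM => hM.2.1
  have hTX : c.top ≤ X := hX ▸ le_sInf fun M hM => hM.2.2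
  have hXle : ∀ P, IsCoatom P → H ≤ P → c.top ≤ P → X ≤ P := fun P h1 h2 h3 =>
    hX ▸ sInf_le ⟨h1, h2, h3⟩
  let W₀ := fixedSubmodule c.Carrier H
  have hHW : H ≤ cent G (W₀ : Set c.Carrier) := le_cent_fixedSubmodule H
  have hTW : c.top ≤ cent G (W₀ : Set c.Carrier) := fun x hx =>
    (mem_fixingSubgroup_iff G).2 fun v _ =>
      c.mem_centralizer.1 (c.top_le_centralizer hx) v
  obtain ⟨W', hrank, hW'⟩ := hc W₀
  obtain ⟨s, hs, rfl⟩ := exists_finset_span_eq c.isIrreducibleModule W' hrank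
  rw [cent_span] at hW'
  have hXW : X ⊓ cent G (s : Set c.Carrier) ≤ cent G (W₀ : Set c.Carrier) := by
    rw [hW', inf_comm]
    exact inf_le_inf_left _ (le_sInf fun M hM =>
      hXle M hM.1 (hHW.trans hM.2) (hTW.trans hM.2))
  choose rep hrep using c.cls_surjective
  -- `none` gives L itself and each v ∈ s a conjugate of L meeting L in the stabilizer of v in L: at
  -- most γ + 1 new subgroups.
  let M : Fin t ⊕ Option s → Subgroup G :=
    Sum.elim M₀ fun o => o.elim L fun v => L.map (MulAut.conj (rep v : G)).toMonoidHom
  have hq : ∀ o, (M (Sum.inr o)).index = L.index := by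
    rintro (_ | v)
    · rfl
    · exact index_map_conj L _
  refine IsEtaIntersection.of_fintype M ?_ (le_antisymm (le_iInf ?_) ?_) ?_
  · rintro (i | _ | v)
    · exact hM₀ i
    · exact hL.isCoatom
    · exact isCoatom_map_conj hL.isCoatom _
  · rintro (i | _ | v)
    · exact hHX.trans (hXM ▸ iInf_le M₀ i)
    · exact hHL
    · intro y hy
      refine (hL.mem_conj_iff (hHL hy) (rep v)).2 ?_
      rw [hrep]
      exact (mem_fixingSubgroup_iff G).1 ((hHW.trans (hW'.le.trans inf_le_left)) hy) (v : c.Carrier) v.2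
  · have h1 : ⨅ i, M i ≤ X := hXM ▸ le_iInf fun i => iInf_le M (Sum.inl i)
    have h2 : ⨅ i, M i ≤ L := iInf_le M (Sum.inr none)
    have h3 : ⨅ i, M i ≤ cent G (s : Set c.Carrier) := fun x hx => by
      refine (mem_fixingSubgroup_iff G).2 fun v hv => ?_
      have := (hL.mem_conj_iff (h2 hx) (rep v)).1
        (iInf_le M (Sum.inr (some ⟨v, hv⟩)) hx)
      rwa [hrep] at this
    have h4 := le_inf (le_inf h1 h2) ((le_inf h1 h3).trans hXW)
    conv_rhs => rw [hH]
    refine le_sInf fun P hP => ?_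
    by_cases hTP : c.top ≤ P
    · exact h1.trans (hXle P hP.1 hP.2 hTP)
    · exact h4.trans (hL.inf_cent_inf_le ⟨hP.1, hbot.trans hP.2, hTP⟩ hHL hP.2 hXle)
  · have hidx : L.index * X.index ≤ H.index := by
      have h1 : (L ⊓ X).relIndex X * X.index = (L ⊓ X).index :=
        Subgroup.relIndex_mul_index inf_le_right
      rw [Subgroup.inf_relIndex_right] at h1
      -- X contains `c.top`, and L already has full index relative to `c.top`.
      have h2 : L.index ≤ L.relIndex X := by
        rw [← relIndex_eq_index_of_sup_eq_top hL.sup_top]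
        exact Subgroup.relIndex_le_of_le_right hTX
          (Subgroup.index_ne_zero_of_finite)
      calc L.index * X.index ≤ (L ⊓ X).index := h1 ▸ Nat.mul_le_mul_right _ h2
        _ ≤ H.index := Subgroup.index_antitone (le_inf hHL hHX)
    -- This allows the exponent `s.card + 1` to be raised to γ + 1.
    have hq1 : (1 : ℝ) ≤ L.index := by
      exact_mod_cast Nat.one_le_iff_ne_zero.2 Subgroup.index_ne_zero_of_finite
    have hidx' : (X.index : ℝ) * L.index ≤ H.index := by
      rw [mul_comm]
      exact_mod_cast hidx
    rw [Fintype.prod_sum_type]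
    have e1 : ∏ o, ((M (Sum.inr o)).index : ℝ) = (L.index : ℝ) ^ (s.card + 1) := by
      simp [hq]
    rw [e1]
    calc (∏ i, ((M₀ i).index : ℝ)) * (L.index : ℝ) ^ (s.card + 1)
        ≤ (X.index : ℝ) ^ ((γ : ℝ) + 1) * (L.index : ℝ) ^ (γ + 1) := by
          gcongr
      _ = ((X.index : ℝ) * L.index) ^ ((γ : ℝ) + 1) := by
          rw [Real.mul_rpow (by positivity) (by positivity)]
          congr 1
          exact_mod_cast (Real.rpow_natCast (L.index : ℝ) (γ + 1)).symm
      _ ≤ (H.index : ℝ) ^ ((γ : ℝ) + 1) := by gcongr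

/-- Maximal intersections are the closed elements for the closure by maximal subgroups. -/
theorem IsMaximalIntersection.eq_sInf {G : Type*} [Group G] {H : Subgroup G}
    (hH : IsMaximalIntersection H) : H = sInf {M | IsCoatom M ∧ H ≤ M} := by
  obtain ⟨S, hS, h⟩ := hH
  refine le_antisymm (le_sInf fun M hM => hM.2) ?_
  conv_rhs => rw [h]
  exact sInf_le_sInf fun M hM => ⟨hS M hM, h ▸ sInf_le hM⟩

theorem isEtaIntersection_of_normal_le {γ : ℕ}
    (h : ∀ c : ChiefFactor G, c.IsComplemented → IsGammaModule G c.Carrier γ) (K : Subgroup G) :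
    K.Normal → ∀ H : Subgroup G, IsMaximalIntersection H → K ≤ H →
      IsEtaIntersection ((γ : ℝ) + 1) H := by
  -- The hypothesis covers strictly larger normal subgroups; it is applied to `c.top`, which lies in
  -- X even when not in H.
  induction K using WellFoundedGT.induction with
  | ind K ih =>
  intro hK H hH hKH
  by_cases hKT : K = ⊤
  · obtain rfl : H = ⊤ := top_le_iff.1 (hKT ▸ hKH)
    exact ⟨0, Fin.elim0, fun i => i.elim0, iInf_of_empty _ |>.symm, by simp⟩
  obtain ⟨c, rfl⟩ := exists_chiefFactor_bot_eq K hKT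
  have ih' := ih c.top c.lt c.top_normal
  by_cases hT : c.top ≤ H
  · exact ih' H hH hT
  have hH' := hH.eq_sInf
  obtain ⟨L, hL, hTL⟩ : ∃ L ∈ {M | IsCoatom M ∧ H ≤ M}, ¬ c.top ≤ L := by
    by_contra! hcon
    exact hT (hH' ▸ le_sInf hcon)
  have hLs : c.IsMaximalSupplement L := ⟨hL.1, hKH.trans hL.2, hTL⟩
  exact isEtaIntersection_of_chiefFactor (h c hLs.isComplemented) hLs hH' hKH hL.2 rfl
    (ih' _ ⟨_, fun M hM => hM.1, rfl⟩ (le_sInf fun M hM => hM.2.2))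

end Main

end MaxInter

theorem mainTheorem7 {G : Type*} [Group G] [Finite G] [Group.IsSolvable G]
    (γ : ℕ) (hγ : 0 < γ)
    (h : ∀ c : MaxInter.ChiefFactor G, c.IsComplemented → MaxInter.IsGammaModule G c.Carrier γ) :
    MaxInter.HasIntersectionProperty G ((γ : ℝ) + 1) := by
  intro H hH
  exact MaxInter.isEtaIntersection_of_normal_le h ⊥ inferInstance H hH bot_le
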